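/- Let $k\ge 2$ and $t\ge 1$ be integers, and for $1\le i\le k$ let $p_i,q_i\ge 0$ be integers with $n_i:=tp_i+q_i\ge 1$. Let $G$ be the generalized blow-up of the complete graph $K_k$: the vertex set of $G$ is the disjoint union of the vertex sets of the graphs $G_i=p_iK_t\cup q_iK_1$ ($1\le i\le k$), each $G_i$ is an induced subgraph of $G$, and every vertex of $G_i$ is adjacent to every vertex of $G_j$ whenever $i\ne j$. Let $n=|V(G)|=\sum_{i}n_i$. Write $V_i^{p_i}$ for the set of vertices of the $p_i$ copies of $K_t$ in $G_i$ and $V_i^{q_i}$ for the set of vertices of the $q_i$ copies of $K_1$ in $G_i$. The graph $G$ is connected; let $R_G(u,v)$ be the resistance distance between $u$ and $v$, that is, the potential difference between $u$ and $v$ when every edge of $G$ is a unit resistor and a unit current enters at $u$ and leaves at $v$. Then the following hold. (i) For $1\le i\le k$ and $u\neq v$, $$R_G(u,v)=\begin{cases} \dfrac{2}{n-n_i}, & \text{if } u,v\in V_i^{q_i};\\[2mm] \dfrac{2(n-n_i)+t+1}{(n-n_i)(n-n_i+t)}, & \text{if } u\in V_i^{p_i},\ v\in V_i^{q_i};\\[2mm]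 \dfrac{2}{n-n_i+t}, & \text{if } u,v\in V_i^{p_i},\ uv\in E(G);\\[2mm] \dfrac{2(n-n_i+1)}{(n-n_i)(n-n_i+t)}, & \text{if } u,v\in V_i^{p_i},\ uv\notin E(G). \end{cases}$$ (ii) For $1\le i\neq j\le k$, $$R_G(u,v)=\begin{cases} \dfrac{(n-1)(2n-n_i-n_j)}{n(n-n_i)(n-n_j)}, & \text{if } u\in V_i^{q_i},\ v\in V_j^{q_j};\\[2mm] \dfrac{(n-1)(n-n_i+1)+1-t}{n(n-n_i)(n-n_i+t)}+\dfrac{n-1}{n(n-n_j)}, & \text{if } u\in V_i^{p_i},\ v\in V_j^{q_j};\\[2mm] \dfrac{(n-1)(n-n_i+1)+1-t}{n(n-n_i)(n-n_i+t)}+\dfrac{(n-1)(n-n_j+1)+1-t}{n(n-n_j)(n-n_j+t)}, & \text{if } u\in V_i^{p_i},\ v\in V_j^{p_j}. \end{cases}$$ -/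

import Mathlib

namespace BlowUp

section Resistance

variable {V : Type*} [Fintype V]

open Classical in
/-- `f` is an electric potential on the graph `G`, every edge of which is a unit resistor, when one
unit of current enters the network at `u` and leaves it at `v`: by Ohm's law the current along an
edge from `x` to `y` is `f x - f y`, and by Kirchhoff's current law the net current out of `x` is
`1` at `u`, `-1` at `v` and `0` elsewhere (and `0` everywhere if `u = v`). -/
def IsUnitPotential (G : SimpleGraph V) (u v : V) (f : V → ℝ) : Prop :=
  ∀ x : V, ∑ y : V, (if G.Adj x y then f x - f y else 0) =
    (if x = u then 1 else 0) - (if x = v then 1 else 0)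

open Classical in
/-- The resistance distance between `u` and `v` in `G`: the potential difference between `u` and `v`
when a unit current flows from `u` to `v`. It does not depend on the potential chosen
(`resistanceDist_eq`). A potential exists whenever `G` is connected; the value `0` is
a convention for pairs of vertices that lie in different components. -/
noncomputable def resistanceDist (G : SimpleGraph V) (u v : V) : ℝ :=
  if h : ∃ f : V → ℝ, IsUnitPotential G u v f then h.choose u - h.choose v else 0

theorem sum_laplacian_symm (G : SimpleGraph V) (f g : V → ℝ) [DecidableRel G.Adj] :
    ∑ x : V, g x * ∑ y : V, (if G.Adj x y then f x - f y else 0) =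
      ∑ x : V, f x * ∑ y : V, (if G.Adj x y then g x - g y else 0) := by
  rw [← sub_eq_zero, ← Finset.sum_sub_distrib]
  have h1 : ∀ x : V, g x * ∑ y : V, (if G.Adj x y then f x - f y else 0) -
      f x * ∑ y : V, (if G.Adj x y then g x - g y else 0) =
      (∑ y : V, if G.Adj x y then f x * g y else 0) -
        ∑ y : V, if G.Adj y x then f y * g x else 0 := by
    intro x
    rw [Finset.mul_sum, Finset.mul_sum, ← Finset.sum_sub_distrib, ← Finset.sum_sub_distrib]
    refine Finset.sum_congr rfl fun y _ => ?_
    by_cases h : G.Adj x y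
    · simp only [h, h.symm, if_true]; ring
    · have h' : ¬ G.Adj y x := fun e => h e.symm
      simp [h, h']
  rw [Finset.sum_congr rfl fun x _ => h1 x, Finset.sum_sub_distrib, sub_eq_zero]
  exact Finset.sum_comm

/-- The resistance distance can be read off from any potential of a unit current. -/
theorem resistanceDist_eq (G : SimpleGraph V) {u v : V} {f : V → ℝ}
    (hf : IsUnitPotential G u v f) : resistanceDist G u v = f u - f v := by
  classical
  have h : ∃ f : V → ℝ, IsUnitPotential G u v f := ⟨f, hf⟩
  have hg : IsUnitPotential G u v h.choose := h.choose_spec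
  rw [resistanceDist, dif_pos h]
  generalize h.choose = g at hg
  have key := sum_laplacian_symm G f g
  have e1 : ∀ x, ∑ y : V, (if G.Adj x y then f x - f y else 0) =
    (if x = u then 1 else 0) - (if x = v then 1 else 0) := fun x => by
      convert hf x
  have e2 : ∀ x, ∑ y : V, (if G.Adj x y then g x - g y else 0) =
    (if x = u then 1 else 0) - (if x = v then 1 else 0) := fun x => by
      convert hg x
  simpa [e1, e2, mul_sub, Finset.sum_sub_distrib] using key

theorem IsUnitPotential.neg {G : SimpleGraph V} {u v : V} {f : V → ℝ}
    (hf : IsUnitPotential G u v f) : IsUnitPotential G v u (fun x => -f x) := by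
  classical
  intro x
  have h := hf x
  have h2 : (if x = v then (1 : ℝ) else 0) - (if x = u then 1 else 0) =
      -((if x = u then 1 else 0) - (if x = v then 1 else 0)) := by ring
  rw [h2, ← h, ← Finset.sum_neg_distrib]
  refine Finset.sum_congr rfl fun y _ => ?_
  split_ifs <;> ring

theorem resistanceDist_comm (G : SimpleGraph V) (u v : V) :
    resistanceDist G u v = resistanceDist G v u := by
  by_cases h : ∃ f : V → ℝ, IsUnitPotential G u v f
  · obtain ⟨f, hf⟩ := h
    rw [resistanceDist_eq G hf, resistanceDist_eq G hf.neg]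
    ring
  · have h' : ¬ ∃ f : V → ℝ, IsUnitPotential G v u f := fun ⟨f, hf⟩ => h ⟨_, hf.neg⟩
    rw [resistanceDist, resistanceDist, dif_neg h, dif_neg h']

end Resistance

/-- The generalized join `H[G₁, …, G_k]`: the disjoint union of the graphs `G i`, in which moreover
every vertex of `G i` is joined to every vertex of `G j` whenever `i` and `j` are adjacent in
`H`. -/
def generalizedJoin {ι : Type*} {W : ι → Type*} (H : SimpleGraph ι)
    (G : (i : ι) → SimpleGraph (W i)) : SimpleGraph (Σ i, W i) where
  Adj x y := H.Adj x.1 y.1 ∨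
    ∃ (i : ι) (a b : W i), x = ⟨i, a⟩ ∧ y = ⟨i, b⟩ ∧ (G i).Adj a b
  symm := ⟨by
    rintro x y (h | ⟨i, a, b, hx, hy, h⟩)
    · exact Or.inl h.symm
    · exact Or.inr ⟨i, b, a, hy, hx, h.symm⟩⟩
  loopless := ⟨by
    rintro x (h | ⟨i, a, b, hx, hy, h⟩)
    · exact H.irrefl h
    · obtain rfl : a = b := eq_of_heq (Sigma.mk.inj (hx.symm.trans hy)).2
      exact (G i).irrefl h⟩

/-- The disjoint union `p K_t` of `p` complete graphs on `t` vertices; `(c, s)` is vertex number `s`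
of copy number `c`. -/
def cliqueCopies (p t : ℕ) : SimpleGraph (Fin p × Fin t) where
  Adj x y := x.1 = y.1 ∧ x.2 ≠ y.2
  symm := ⟨fun _ _ h => ⟨h.1.symm, h.2.symm⟩⟩
  loopless := ⟨fun _ h => h.2 rfl⟩

/-- The graph `p K_t ∪ q K₁` (disjoint union). -/
def part (t p q : ℕ) : SimpleGraph ((Fin p × Fin t) ⊕ Fin q) :=
  SimpleGraph.sum (cliqueCopies p t) (⊥ : SimpleGraph (Fin q))

/-- The vertices of the generalized blow-up. -/
abbrev Vertex {k : ℕ} (t : ℕ) (p q : Fin k → ℕ) : Type :=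
  Σ i : Fin k, (Fin (p i) × Fin t) ⊕ Fin (q i)

/-- The generalized blow-up of `H`: the generalized join of the graphs `G_i = p_i K_t ∪ q_i K₁`. -/
def generalizedBlowUp {k : ℕ} (H : SimpleGraph (Fin k)) (t : ℕ) (p q : Fin k → ℕ) :
    SimpleGraph (Vertex t p q) :=
  generalizedJoin H fun i => part t (p i) (q i)

/-- `V_i^{p_i}`: the vertices of `G_i` that lie in one of the `p_i` copies of `K_t`. -/
def cliqueVertices {k : ℕ} (t : ℕ) (p q : Fin k → ℕ) (i : Fin k) : Set (Vertex t p q) :=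
  {x | ∃ a : Fin (p i) × Fin t, x = ⟨i, Sum.inl a⟩}

/-- `V_i^{q_i}`: the vertices of `G_i` that are one of the `q_i` copies of `K₁`. -/
def singleVertices {k : ℕ} (t : ℕ) (p q : Fin k → ℕ) (i : Fin k) : Set (Vertex t p q) :=
  {x | ∃ b : Fin (q i), x = ⟨i, Sum.inr b⟩}

end BlowUp

/-! Write L for the Laplacian, m for the number of vertices outside the part of u, so m = n - n_i.
If L g_u = δ_u - 1/n for every u, then g_u - g_v is a potential for a unit current from u to v, and
the resistance is g_u(u) - g_u(v) - g_v(u) + g_v(v).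

Such a g_u exists in the span of three indicators: of u, of its clique, and of its part. L maps each
into the span of these and the indicator of the outside of the part (`netCurrent_single`,
`netCurrent_clique`, `netCurrent_part`), so the coefficients solve a triangular system;
`netCurrent_green` checks the solution. Since g_u vanishes outside the part of u, the resistance
between different parts is g_u(u) + g_v(v), which is why those formulas are sums. -/

namespace BlowUp

/-! ### Green's functions and resistance in complete multipartite graphs with added cliques -/

section Green

variable {V ι : Type*} [Fintype V]

open Classical in
/-- The net current out of `x` when the potential on `G` is `f`. -/
noncomputable def netCurrent (G : SimpleGraph V) (f : V → ℝ) (x : V) : ℝ :=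
  ∑ y : V, if G.Adj x y then f x - f y else 0

theorem netCurrent_sub (G : SimpleGraph V) (f g : V → ℝ) (x : V) :
    netCurrent G (fun y => f y - g y) x = netCurrent G f x - netCurrent G g x := by
  simp only [netCurrent, ← Finset.sum_sub_distrib]
  refine Finset.sum_congr rfl fun y _ => ?_
  split_ifs <;> ring

theorem netCurrent_linear (G : SimpleGraph V) (a b c : ℝ) (f g h : V → ℝ) (x : V) :
    netCurrent G (fun y => a * f y + b * g y - c * h y) x =
      a * netCurrent G f x + b * netCurrent G g x - c * netCurrent G h x := by
  simp only [netCurrent, Finset.mul_sum, ← Finset.sum_add_distrib, ← Finset.sum_sub_distrib]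
  refine Finset.sum_congr rfl fun y _ => ?_
  split_ifs <;> ring

/-- If each vertex `u` has a Green's function `g u`, whose net current is a unit source at `u`
and a background drain `c` not depending on `u`, then the resistance distance is given by `g`. -/
theorem resistanceDist_eq_of_green [DecidableEq V] (G : SimpleGraph V) (g : V → V → ℝ) (c : ℝ)
    (hg : ∀ u x, netCurrent G (g u) x = (if x = u then 1 else 0) - c) (u v : V) :
    resistanceDist G u v = g u u - g u v - g v u + g v v := by
  have h : IsUnitPotential G u v (fun y => g u y - g v y) := by
    intro x
    have := netCurrent_sub G (g u) (g v) x
    rw [hg, hg] at this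
    rw [netCurrent] at this
    rw [this]
    by_cases h1 : x = u <;> by_cases h2 : x = v <;> simp [h1, h2]
  rw [resistanceDist_eq G h]
  ring

/-- `G` is a complete multipartite graph with parts the fibres of `π`, to which are added, inside
the parts, disjoint cliques with `t` vertices; `C x y` says that `x` and `y` lie in the same
clique. -/
structure IsCliqueBlowUp (G : SimpleGraph V) (π : V → ι) (C : V → V → Prop) (t : ℕ) : Prop where
  adj_iff : ∀ x y, G.Adj x y ↔ π x ≠ π y ∨ (C x y ∧ x ≠ y)
  part_eq : ∀ x y, C x y → π x = π y
  symm : ∀ x y, C x y → C y x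
  trans : ∀ x y z, C x y → C y z → C x z
  card_clique : ∀ x, C x x → {y | C x y}.ncard = t

namespace IsCliqueBlowUp

variable {G : SimpleGraph V} {π : V → ι} {C : V → V → Prop} {t : ℕ}

-- Inside a part, current flows only along clique edges. The diagonal term y = x may be kept, since
-- it contributes zero.
open Classical in
theorem netCurrent_eq (hG : IsCliqueBlowUp G π C t) (f : V → ℝ) (x : V) :
    netCurrent G f x = (∑ y, if π y ≠ π x then f x - f y else 0) +
      ∑ y, if C x y then f x - f y else 0 := by
  rw [netCurrent, ← Finset.sum_add_distrib]
  refine Finset.sum_congr rfl fun y _ => ?_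
  have h1 := hG.adj_iff x y
  have h2 := hG.part_eq x y
  by_cases hxy : x = y
  · subst hxy; simp
  · by_cases h : π x = π y
    · simp [h1, h, hxy]
    · have h3 : ¬ C x y := fun e => h (h2 e)
      simp [h1, h, h3, Ne.symm h]

open Classical in
theorem sum_clique (hG : IsCliqueBlowUp G π C t) {x : V} (hx : C x x) :
    (∑ y, if C x y then (1 : ℝ) else 0) = t := by
  have h := hG.card_clique x hx
  rw [Set.ncard_eq_toFinset_card'] at h
  rw [Finset.sum_boole, ← h]
  congr 2
  ext; simp

variable (π) in
/-- The number of vertices outside the part `i`. -/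
noncomputable def coPart (i : ι) : ℝ := ({y | π y ≠ i} : Set V).ncard

open Classical in
theorem sum_coPart (i : ι) : (∑ y, if π y ≠ i then (1 : ℝ) else 0) = coPart π i := by
  rw [coPart, Set.ncard_eq_toFinset_card', Finset.sum_boole]
  congr 2
  ext; simp

open Classical in
/-- The current across the parts for a potential that vanishes outside one part. -/
theorem sum_cross (f : V → ℝ) (i : ι) (hf : ∀ y, π y ≠ i → f y = 0) (x : V) :
    (∑ y, if π y ≠ π x then f x - f y else 0) =
      coPart π i * f x - (if π x ≠ i then ∑ y, f y else 0) := by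
  by_cases hx : π x = i
  · subst hx
    rw [← sum_coPart, Finset.sum_mul]
    simp only [ne_eq, not_true_eq_false, if_false, sub_zero]
    refine Finset.sum_congr rfl fun y _ => ?_
    by_cases h : π y = π x
    · simp [h]
    · simp [h, hf y h]
  · simp only [hf x hx, ne_eq, hx, not_false_eq_true, if_true, mul_zero, zero_sub,
      ← Finset.sum_neg_distrib]
    refine Finset.sum_congr rfl fun y _ => ?_
    by_cases h : π y = π x
    · simp [h, hf y (h ▸ hx)]
    · simp [h]

-- The clique of u is counted with u itself: the coefficient m + t exceeds the degree m + t - 1 by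
-- one, and the last term compensates at x = u.
open Classical in
theorem netCurrent_single (hG : IsCliqueBlowUp G π C t) (u x : V) :
    netCurrent G (fun y => if y = u then 1 else 0) x =
      (coPart π (π u) + if C u u then (t : ℝ) else 0) * (if x = u then 1 else 0) -
        (if π x ≠ π u then 1 else 0) - (if C u x then 1 else 0) := by
  rw [hG.netCurrent_eq, sum_cross (fun y => if y = u then (1 : ℝ) else 0) (π u)
    (fun y hy => if_neg fun e => hy (e ▸ rfl))]
  have h1 : (∑ y, if C x y then
      (if x = u then (1 : ℝ) else 0) - (if y = u then 1 else 0) else 0) =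
      (if C u u then (t : ℝ) else 0) * (if x = u then 1 else 0) - (if C u x then 1 else 0) := by
    have h2 : ∀ y, (if C x y then
        (if x = u then (1 : ℝ) else 0) - (if y = u then 1 else 0) else 0) =
        (if C x y then 1 else 0) * (if x = u then 1 else 0) -
          (if y = u then (if C x u then 1 else 0) else 0) := by
      intro y
      by_cases hy : y = u
      · subst hy; split_ifs <;> simp
      · by_cases hc : C x y <;> simp [hy, hc]
    rw [Finset.sum_congr rfl fun y _ => h2 y, Finset.sum_sub_distrib, ← Finset.sum_mul]
    have h3 : C x u ↔ C u x := ⟨hG.symm _ _, hG.symm _ _⟩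
    simp only [Finset.sum_ite_eq', Finset.mem_univ, if_true, h3]
    by_cases hx : x = u
    · subst hx
      by_cases hc : C x x
      · simp [hG.sum_clique hc, hc]
      -- `C` is not assumed reflexive: `C x x` says that x is a clique vertex. Otherwise symmetry
      -- and transitivity leave x related to nothing.
      · have : ∀ y, ¬ C x y := fun y h => hc (hG.trans _ _ _ h (hG.symm _ _ h))
        simp [this]
    · simp [hx]
  rw [h1]
  simp only [Finset.sum_ite_eq', Finset.mem_univ, if_true]
  ring

-- The indicator is constant on every clique, so only edges across parts carry current: m at each
-- vertex of the clique, t into each vertex outside the part.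
open Classical in
theorem netCurrent_clique (hG : IsCliqueBlowUp G π C t) {u : V} (hu : C u u) (x : V) :
    netCurrent G (fun y => if C u y then 1 else 0) x =
      coPart π (π u) * (if C u x then 1 else 0) - (if π x ≠ π u then (t : ℝ) else 0) := by
  rw [hG.netCurrent_eq, sum_cross _ (π u) (fun y hy => if_neg fun e => hy (hG.part_eq _ _ e).symm),
    hG.sum_clique hu, add_eq_left]
  refine Finset.sum_eq_zero fun y _ => ?_
  by_cases h : C x y
  · have : C u x ↔ C u y := ⟨fun e => hG.trans _ _ _ e h, fun e => hG.trans _ _ _ e (hG.symm _ _ h)⟩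
    simp [this]
  · simp [h]

open Classical in
theorem netCurrent_part (hG : IsCliqueBlowUp G π C t) (i : ι) (x : V) :
    netCurrent G (fun y => if π y = i then 1 else 0) x =
      coPart π i * (if π x = i then 1 else 0) -
        (if π x ≠ i then Fintype.card V - coPart π i else 0) := by
  have h1 : (∑ y, if π y = i then (1 : ℝ) else 0) = Fintype.card V - coPart π i := by
    rw [← sum_coPart, eq_sub_iff_add_eq, ← Finset.sum_add_distrib]
    rw [Finset.sum_congr rfl fun y _ => show _ = (1 : ℝ) by by_cases h : π y = i <;> simp [h]]
    simp
  rw [hG.netCurrent_eq, sum_cross _ i (fun y hy => if_neg hy), h1, add_eq_left]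
  refine Finset.sum_eq_zero fun y _ => ?_
  by_cases h : C x y
  · simp [hG.part_eq _ _ h]
  · simp [h]

open Classical in
variable (π C t) in
/-- The Green's function of the graph with pole `u`, normalized to vanish outside the part
of `u`. -/
noncomputable def green (u x : V) : ℝ :=
  (coPart π (π u) + if C u u then (t : ℝ) else 0)⁻¹ * (if x = u then 1 else 0) +
    (coPart π (π u) * (coPart π (π u) + t))⁻¹ * (if C u x then 1 else 0) -
    ((Fintype.card V : ℝ) * coPart π (π u))⁻¹ * (if π x = π u then 1 else 0)

-- The first term makes the unit source; the second cancels the drain that the first leaves on the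
-- clique; the third puts the drain 1/n on the part. Outside the part the first two then total -1/m
-- and the third gives (n - m)/(nm), again a drain of 1/n.
open Classical in
theorem netCurrent_green (hG : IsCliqueBlowUp G π C t) (hm : ∀ i, 0 < coPart π i) (u x : V) :
    netCurrent G (green π C t u) x = (if x = u then 1 else 0) - (Fintype.card V : ℝ)⁻¹ := by
  have hn : (0 : ℝ) < Fintype.card V := by exact_mod_cast Fintype.card_pos_iff.2 ⟨u⟩
  have hm := hm (π u)
  have ht : 0 < coPart π (π u) + (t : ℝ) := by positivity
  unfold green
  rw [netCurrent_linear, hG.netCurrent_single, hG.netCurrent_part]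
  by_cases hu : C u u
  · rw [hG.netCurrent_clique hu]
    simp only [hu, if_true]
    generalize coPart π (π u) = m at *
    by_cases hx : π x = π u
    · simp only [hx, ne_eq, not_true_eq_false, if_false, if_true]
      field_simp
      ring
    · have h1 : x ≠ u := fun e => hx (e ▸ rfl)
      have h2 : ¬ C u x := fun e => hx (hG.part_eq _ _ e).symm
      simp only [hx, h1, h2, ne_eq, not_false_eq_true, if_false, if_true]
      field_simp
      ring
  · have hc : ∀ y, ¬ C u y := fun y h => hu (hG.trans _ _ _ h (hG.symm _ _ h))
    have h0 : netCurrent G (fun y => if C u y then 1 else 0) x = 0 := by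
      simp [netCurrent, hc]
    rw [h0]
    simp only [hc, if_false]
    generalize coPart π (π u) = m at *
    by_cases hx : π x = π u
    · simp only [hx, ne_eq, not_true_eq_false, if_false, if_true]
      field_simp
      ring
    · have h1 : x ≠ u := fun e => hx (e ▸ rfl)
      simp only [hx, h1, ne_eq, not_false_eq_true, if_false, if_true]
      field_simp
      ring

theorem resistanceDist_eq_green (hG : IsCliqueBlowUp G π C t) (hm : ∀ i, 0 < coPart π i)
    (u v : V) : resistanceDist G u v =
      green π C t u u - green π C t u v - green π C t v u + green π C t v v := by
  classical
  exact resistanceDist_eq_of_green G _ _ (fun u x => by rw [hG.netCurrent_green hm]) u v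

section Values

variable {u v : V}

theorem green_self_of_clique (hu : C u u) : green π C t u u =
    (coPart π (π u) + t)⁻¹ + (coPart π (π u) * (coPart π (π u) + t))⁻¹ -
      (Fintype.card V * coPart π (π u))⁻¹ := by
  simp [green, hu]

theorem green_self_of_not_clique (hu : ¬ C u u) : green π C t u u =
    (coPart π (π u))⁻¹ - (Fintype.card V * coPart π (π u))⁻¹ := by
  simp [green, hu]

theorem green_of_clique (hG : IsCliqueBlowUp G π C t) (h : C u v) (hne : u ≠ v) :
    green π C t u v = (coPart π (π u) * (coPart π (π u) + t))⁻¹ -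
      (Fintype.card V * coPart π (π u))⁻¹ := by
  simp [green, h, hne.symm, hG.part_eq _ _ h]

theorem green_of_not_clique (h : ¬ C u v) (hp : π u = π v) (hne : u ≠ v) :
    green π C t u v = -(Fintype.card V * coPart π (π u))⁻¹ := by
  simp [green, h, hne.symm, hp]

theorem green_of_part_ne (hG : IsCliqueBlowUp G π C t) (hp : π u ≠ π v) :
    green π C t u v = 0 := by
  have h : ¬ C u v := fun e => hp (hG.part_eq _ _ e)
  have hne : v ≠ u := fun e => hp (e ▸ rfl)
  simp [green, h, hne, hp.symm]

end Values

end IsCliqueBlowUp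

end Green

/-! ### The blow-up of the complete graph as an instance -/

section Blow

variable {k t : ℕ} {p q : Fin k → ℕ}

/-- `x` and `y` lie in the same copy of `K_t`. -/
def SameClique (x y : Vertex t p q) : Prop :=
  ∃ (i : Fin k) (c : Fin (p i)) (r s : Fin t), x = ⟨i, Sum.inl (c, r)⟩ ∧ y = ⟨i, Sum.inl (c, s)⟩

theorem sameClique_inl {i j : Fin k} {c : Fin (p i)} {r : Fin t}
    {y : (Fin (p j) × Fin t) ⊕ Fin (q j)} :
    SameClique (p := p) (q := q) ⟨i, Sum.inl (c, r)⟩ ⟨j, y⟩ ↔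
      ∃ s, (⟨j, y⟩ : Vertex t p q) = ⟨i, Sum.inl (c, s)⟩ := by
  constructor
  · rintro ⟨i', c', r', s', h, h'⟩
    obtain ⟨rfl, h⟩ := Sigma.mk.inj h
    simp only [heq_eq_eq, Sum.inl.injEq, Prod.mk.injEq] at h
    obtain ⟨rfl, rfl⟩ := h
    exact ⟨s', h'⟩
  · rintro ⟨s, h⟩
    exact ⟨i, c, r, s, rfl, h⟩

theorem isCliqueBlowUp_generalizedBlowUp :
    IsCliqueBlowUp (generalizedBlowUp (SimpleGraph.completeGraph (Fin k)) t p q) Sigma.fst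
      SameClique t where
  adj_iff := by
    intro x y
    simp only [generalizedBlowUp, generalizedJoin, part]
    refine or_congr (by simp [SimpleGraph.completeGraph]) ⟨?_, ?_⟩
    · rintro ⟨i, a, b, rfl, rfl, h⟩
      rcases a with ⟨c, r⟩ | a <;> rcases b with ⟨d, s⟩ | b <;> simp [cliqueCopies] at h
      obtain ⟨rfl, h⟩ := h
      exact ⟨⟨i, c, r, s, rfl, rfl⟩, by simpa using h⟩
    · rintro ⟨⟨i, c, r, s, rfl, rfl⟩, h⟩
      exact ⟨i, _, _, rfl, rfl, by simpa [cliqueCopies] using h⟩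
  part_eq := by
    rintro _ _ ⟨i, c, r, s, rfl, rfl⟩
    rfl
  symm := by
    rintro _ _ ⟨i, c, r, s, rfl, rfl⟩
    exact ⟨i, c, s, r, rfl, rfl⟩
  trans := by
    rintro _ _ _ ⟨i, c, r, s, rfl, rfl⟩ h
    obtain ⟨s', h⟩ := sameClique_inl.1 h
    exact ⟨i, c, r, s', rfl, h⟩
  card_clique := by
    rintro _ ⟨i, c, r, s, rfl, -⟩
    have h : {y : Vertex t p q | SameClique ⟨i, Sum.inl (c, r)⟩ y} =
        Set.range fun s : Fin t => (⟨i, Sum.inl (c, s)⟩ : Vertex t p q) := by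
      ext ⟨j, y⟩
      simp only [Set.mem_ofPred_eq, sameClique_inl, Set.mem_range, eq_comm]
    rw [h, ← Set.image_univ, Set.ncard_image_of_injective _ (fun a b h => by simpa using h)]
    simp

theorem coPart_vertex (i : Fin k) :
    IsCliqueBlowUp.coPart (Sigma.fst : Vertex t p q → Fin k) i =
      Fintype.card (Vertex t p q) - ((t * p i + q i : ℕ) : ℝ) := by
  classical
  have h1 : ({y : Vertex t p q | y.1 = i}).ncard = t * p i + q i := by
    have h : {y : Vertex t p q | y.1 = i} = Set.range (Sigma.mk i) := by
      ext ⟨j, y⟩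
      constructor
      · rintro rfl; exact ⟨y, rfl⟩
      · rintro ⟨z, h⟩; exact (congrArg Sigma.fst h).symm
    rw [h, ← Set.image_univ, Set.ncard_image_of_injective _ sigma_mk_injective, Set.ncard_univ]
    simp [mul_comm]
  have h2 := Set.ncard_add_ncard_compl {y : Vertex t p q | y.1 = i}
  rw [h1, Nat.card_eq_fintype_card] at h2
  rw [IsCliqueBlowUp.coPart, ← h2]
  push_cast
  rw [add_sub_cancel_left]
  rfl

theorem exists_vertex_fst_eq (hpos : ∀ i, 0 < t * p i + q i) (i : Fin k) :
    ∃ y : Vertex t p q, y.1 = i := by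
  have h : 0 < Fintype.card ((Fin (p i) × Fin t) ⊕ Fin (q i)) := by
    have := hpos i
    simpa [mul_comm] using this
  obtain ⟨y⟩ := Fintype.card_pos_iff.1 h
  exact ⟨⟨i, y⟩, rfl⟩

/-- With k ≥ 2 and no empty part, another part supplies a vertex. This keeps the denominators
nonzero. -/
theorem coPart_pos (hk : 2 ≤ k) (hpos : ∀ i, 0 < t * p i + q i) (i : Fin k) :
    0 < IsCliqueBlowUp.coPart (Sigma.fst : Vertex t p q → Fin k) i := by
  have : Nontrivial (Fin k) := Fin.nontrivial_iff_two_le.2 hk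
  obtain ⟨j, hj⟩ := exists_ne i
  obtain ⟨y, rfl⟩ := exists_vertex_fst_eq hpos j
  rw [IsCliqueBlowUp.coPart, Nat.cast_pos, Set.ncard_pos]
  exact ⟨y, hj⟩

theorem connected_generalizedBlowUp (hk : 2 ≤ k) (hpos : ∀ i, 0 < t * p i + q i) :
    (generalizedBlowUp (SimpleGraph.completeGraph (Fin k)) t p q).Connected := by
  have : Nontrivial (Fin k) := Fin.nontrivial_iff_two_le.2 hk
  have hadj : ∀ x y : Vertex t p q, x.1 ≠ y.1 →
      (generalizedBlowUp (SimpleGraph.completeGraph (Fin k)) t p q).Adj x y :=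
    fun x y h => (isCliqueBlowUp_generalizedBlowUp.adj_iff x y).2 (Or.inl h)
  have : Nonempty (Vertex t p q) :=
    let ⟨y, _⟩ := exists_vertex_fst_eq (t := t) (p := p) (q := q) hpos ⟨0, by omega⟩
    ⟨y⟩
  refine ⟨fun x y => ?_⟩
  by_cases h : x.1 = y.1
  · obtain ⟨j, hj⟩ := exists_ne x.1
    obtain ⟨z, rfl⟩ := exists_vertex_fst_eq (t := t) (p := p) (q := q) hpos j
    exact (hadj x z hj.symm).reachable.trans (hadj z y (h ▸ hj)).reachable
  · exact (hadj x y h).reachable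

theorem not_sameClique_inr_left {i : Fin k} {b : Fin (q i)} {y : Vertex t p q} :
    ¬ SameClique (⟨i, Sum.inr b⟩ : Vertex t p q) y := by
  rintro ⟨j, c, r, s, h, -⟩
  obtain ⟨rfl, h⟩ := Sigma.mk.inj h
  simp at h

theorem not_sameClique_inr_right {i : Fin k} {b : Fin (q i)} {x : Vertex t p q} :
    ¬ SameClique x (⟨i, Sum.inr b⟩ : Vertex t p q) := by
  rintro ⟨j, c, r, s, -, h⟩
  obtain ⟨rfl, h⟩ := Sigma.mk.inj h
  simp at h

theorem sameClique_self {i : Fin k} {a : Fin (p i) × Fin t} :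
    SameClique (⟨i, Sum.inl a⟩ : Vertex t p q) ⟨i, Sum.inl a⟩ :=
  ⟨i, a.1, a.2, a.2, rfl, rfl⟩

end Blow

end BlowUp

/-! ### The resistance formulas -/

theorem corollaryc31 (k : ℕ) (hk : 2 ≤ k) (t : ℕ) (p q : Fin k → ℕ)
    (N : Fin k → ℝ) (hN : ∀ i, N i = ((t * p i + q i : ℕ) : ℝ)) (hpos : ∀ i, 0 < t * p i + q i)
    (G : SimpleGraph (BlowUp.Vertex t p q))
    (hG : G = BlowUp.generalizedBlowUp (SimpleGraph.completeGraph (Fin k)) t p q)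
    (n : ℝ) (hn : n = (Fintype.card (BlowUp.Vertex t p q) : ℝ)) :
    G.Connected ∧
    (∀ (i : Fin k) (u v : BlowUp.Vertex t p q), u ≠ v →
      (u ∈ BlowUp.singleVertices t p q i → v ∈ BlowUp.singleVertices t p q i →
        BlowUp.resistanceDist G u v = 2 / (n - N i)) ∧
      (u ∈ BlowUp.cliqueVertices t p q i → v ∈ BlowUp.singleVertices t p q i →
        BlowUp.resistanceDist G u v =
          (2 * (n - N i) + t + 1) / ((n - N i) * (n - N i + t))) ∧
      (u ∈ BlowUp.cliqueVertices t p q i → v ∈ BlowUp.cliqueVertices t p q i → G.Adj u v →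
        BlowUp.resistanceDist G u v = 2 / (n - N i + t)) ∧
      (u ∈ BlowUp.cliqueVertices t p q i → v ∈ BlowUp.cliqueVertices t p q i → ¬ G.Adj u v →
        BlowUp.resistanceDist G u v =
          2 * (n - N i + 1) / ((n - N i) * (n - N i + t)))) ∧
    (∀ (i j : Fin k) (u v : BlowUp.Vertex t p q), i ≠ j →
      (u ∈ BlowUp.singleVertices t p q i → v ∈ BlowUp.singleVertices t p q j →
        BlowUp.resistanceDist G u v =
          (n - 1) * (2 * n - N i - N j) / (n * (n - N i) * (n - N j))) ∧
      (u ∈ BlowUp.cliqueVertices t p q i → v ∈ BlowUp.singleVertices t p q j →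
        BlowUp.resistanceDist G u v =
          ((n - 1) * (n - N i + 1) + 1 - t) / (n * (n - N i) * (n - N i + t)) +
            (n - 1) / (n * (n - N j))) ∧
      (u ∈ BlowUp.cliqueVertices t p q i → v ∈ BlowUp.cliqueVertices t p q j →
        BlowUp.resistanceDist G u v =
          ((n - 1) * (n - N i + 1) + 1 - t) / (n * (n - N i) * (n - N i + t)) +
            ((n - 1) * (n - N j + 1) + 1 - t) / (n * (n - N j) * (n - N j + t)))) := by
  subst hG hn
  have hB := BlowUp.isCliqueBlowUp_generalizedBlowUp (k := k) (t := t) (p := p) (q := q)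
  have hm := BlowUp.coPart_pos (t := t) (p := p) (q := q) hk hpos
  have hR := hB.resistanceDist_eq_green hm
  have hc : ∀ i, Fintype.card (BlowUp.Vertex t p q) - N i =
      BlowUp.IsCliqueBlowUp.coPart (Sigma.fst : BlowUp.Vertex t p q → Fin k) i := fun i => by
    rw [hN, BlowUp.coPart_vertex]
  have hs : ∀ i, ∀ u ∈ BlowUp.singleVertices t p q i,
      u.1 = i ∧ ∀ v, ¬ BlowUp.SameClique u v ∧ ¬ BlowUp.SameClique v u := by
    rintro i _ ⟨b, rfl⟩
    exact ⟨rfl, fun v => ⟨BlowUp.not_sameClique_inr_left, BlowUp.not_sameClique_inr_right⟩⟩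
  have hcl : ∀ i, ∀ u ∈ BlowUp.cliqueVertices t p q i, u.1 = i ∧ BlowUp.SameClique u u := by
    rintro i _ ⟨a, rfl⟩
    exact ⟨rfl, BlowUp.sameClique_self⟩
  refine ⟨BlowUp.connected_generalizedBlowUp hk hpos, ?_, ?_⟩
  · intro i u v huv
    have h0 := (hm i).ne'
    have h1 : BlowUp.IsCliqueBlowUp.coPart (Sigma.fst : BlowUp.Vertex t p q → Fin k) i + t ≠ 0 :=
      (add_pos_of_pos_of_nonneg (hm i) t.cast_nonneg).ne'
    rw [hR, hc]
    generalize hmi : BlowUp.IsCliqueBlowUp.coPart (Sigma.fst : BlowUp.Vertex t p q → Fin k) i = m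
      at h0 h1 ⊢
    refine ⟨?_, ?_, ?_, ?_⟩
    · intro hu hv
      obtain ⟨hui, hu⟩ := hs i u hu
      obtain ⟨hvi, hv⟩ := hs i v hv
      rw [BlowUp.IsCliqueBlowUp.green_self_of_not_clique (hu u).1,
        BlowUp.IsCliqueBlowUp.green_self_of_not_clique (hv v).1,
        BlowUp.IsCliqueBlowUp.green_of_not_clique (hu v).1 (hui.trans hvi.symm) huv,
        BlowUp.IsCliqueBlowUp.green_of_not_clique (hv u).1 (hvi.trans hui.symm) huv.symm,
        hui, hvi, hmi]
      ring
    · intro hu hv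
      obtain ⟨hui, hu⟩ := hcl i u hu
      obtain ⟨hvi, hv⟩ := hs i v hv
      rw [BlowUp.IsCliqueBlowUp.green_self_of_clique hu,
        BlowUp.IsCliqueBlowUp.green_self_of_not_clique (hv v).1,
        BlowUp.IsCliqueBlowUp.green_of_not_clique (hv u).2 (hui.trans hvi.symm) huv,
        BlowUp.IsCliqueBlowUp.green_of_not_clique (hv u).1 (hvi.trans hui.symm) huv.symm,
        hui, hvi, hmi]
      -- Within one part, 1/(nm) occurs in all four Green values and cancels, so it can stay opaque;
      -- hence n enters only through m.
      generalize (Fintype.card (BlowUp.Vertex t p q) * m)⁻¹ = z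
      field_simp
      ring
    · intro hu hv h
      obtain ⟨hui, hu⟩ := hcl i u hu
      obtain ⟨hvi, hv⟩ := hcl i v hv
      -- Adjacent vertices of one part lie in a common clique.
      have h2 := (((hB.adj_iff u v).1 h).resolve_left fun e => e (hui.trans hvi.symm)).1
      rw [BlowUp.IsCliqueBlowUp.green_self_of_clique hu,
        BlowUp.IsCliqueBlowUp.green_self_of_clique hv,
        hB.green_of_clique h2 huv, hB.green_of_clique (hB.symm _ _ h2) huv.symm, hui, hvi, hmi]
      ring
    · intro hu hv h
      obtain ⟨hui, hu⟩ := hcl i u hu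
      obtain ⟨hvi, hv⟩ := hcl i v hv
      have h2 : ¬ BlowUp.SameClique u v := fun e => h ((hB.adj_iff u v).2 (Or.inr ⟨e, huv⟩))
      have h3 : ¬ BlowUp.SameClique v u := fun e => h2 (hB.symm _ _ e)
      rw [BlowUp.IsCliqueBlowUp.green_self_of_clique hu,
        BlowUp.IsCliqueBlowUp.green_self_of_clique hv,
        BlowUp.IsCliqueBlowUp.green_of_not_clique h2 (hui.trans hvi.symm) huv,
        BlowUp.IsCliqueBlowUp.green_of_not_clique h3 (hvi.trans hui.symm) huv.symm,
        hui, hvi, hmi]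
      generalize (Fintype.card (BlowUp.Vertex t p q) * m)⁻¹ = z
      field_simp
      ring
  · intro i j u v hij
    have hn : (Fintype.card (BlowUp.Vertex t p q) : ℝ) ≠ 0 :=
      Nat.cast_ne_zero.2 (Fintype.card_pos_iff.2 ⟨u⟩).ne'
    have hsg : ∀ i, ∀ u ∈ BlowUp.singleVertices t p q i, u.1 = i ∧
        BlowUp.IsCliqueBlowUp.green Sigma.fst BlowUp.SameClique t u u =
          (Fintype.card (BlowUp.Vertex t p q) - 1) /
            (Fintype.card (BlowUp.Vertex t p q) * (Fintype.card (BlowUp.Vertex t p q) - N i)) := by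
      intro i u hu
      obtain ⟨hui, hu⟩ := hs i u hu
      have h0 := (hm i).ne'
      rw [BlowUp.IsCliqueBlowUp.green_self_of_not_clique (hu u).1, hui, hc]
      refine ⟨rfl, ?_⟩
      field_simp
    -- This is 1/(m + t) + 1/(m(m + t)) - 1/(nm) over a common denominator, with numerator nm + n -
    -- m - t = (n - 1)(m + 1) + 1 - t.
    have hcg : ∀ i, ∀ u ∈ BlowUp.cliqueVertices t p q i, u.1 = i ∧
        BlowUp.IsCliqueBlowUp.green Sigma.fst BlowUp.SameClique t u u =
          ((Fintype.card (BlowUp.Vertex t p q) - 1) *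
            (Fintype.card (BlowUp.Vertex t p q) - N i + 1) + 1 - t) /
            (Fintype.card (BlowUp.Vertex t p q) * (Fintype.card (BlowUp.Vertex t p q) - N i) *
              (Fintype.card (BlowUp.Vertex t p q) - N i + t)) := by
      intro i u hu
      obtain ⟨hui, hu⟩ := hcl i u hu
      have h0 := (hm i).ne'
      have h1 := (add_pos_of_pos_of_nonneg (hm i) t.cast_nonneg).ne'
      rw [BlowUp.IsCliqueBlowUp.green_self_of_clique hu, hui, hc]
      refine ⟨rfl, ?_⟩
      field_simp
      ring
    have hcross : u.1 = i → v.1 = j → BlowUp.resistanceDist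
        (BlowUp.generalizedBlowUp (SimpleGraph.completeGraph (Fin k)) t p q) u v =
          BlowUp.IsCliqueBlowUp.green Sigma.fst BlowUp.SameClique t u u +
            BlowUp.IsCliqueBlowUp.green Sigma.fst BlowUp.SameClique t v v := by
      rintro rfl rfl
      rw [hR, hB.green_of_part_ne hij, hB.green_of_part_ne hij.symm, sub_zero, sub_zero]
    refine ⟨fun hu hv => ?_, fun hu hv => ?_, fun hu hv => ?_⟩
    · rw [hcross (hsg i u hu).1 (hsg j v hv).1, (hsg i u hu).2, (hsg j v hv).2]
      have hi := (hm i).ne'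
      have hj := (hm j).ne'
      rw [← hc] at hi hj
      field_simp
      ring
    · rw [hcross (hcg i u hu).1 (hsg j v hv).1, (hcg i u hu).2, (hsg j v hv).2]
    · rw [hcross (hcg i u hu).1 (hcg j v hv).1, (hcg i u hu).2, (hcg j v hv).2]
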